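/- Conventions. A generalized Baumslag--Solitar (GBS) group is a group isomorphic to the fundamental group of a finite connected graph of groups all of whose vertex and edge groups are infinite cyclic. A $G$-tree is a metric simplicial tree (the geometric realization, with its path metric, of a tree with positive edge lengths) with an action of $G$ by simplicial isometries without inversions; it is minimal if it contains no proper $G$-invariant subtree. The cyclic deformation space $\mathcal D$ of $G$ is the set of minimal $G$-trees with cyclic vertex and edge stabilizers, up to $G$-equivariant isometry or homothety. The volume $\mathrm{vol}(T/G)$ is the sum of the lengths of the (unoriented) edges of $T/G$. For $G$-trees $T,S$, let \[ \mathrm{Lip}(T,S)=\inf\{\mathrm{Lip}(f) : f:T\to S \text{ a } G\text{-equivariant Lipschitz map}\}, \] with $\inf\emptyset=\infty$. Let $f:T\to S$ be a $G$-equivariant map that is linear on edges, i.e. for each edge $e$ there is a stretch factor $s_e\ge 0$ with $d_S(f(x),f(y))=s_e\,d_T(x,y)$ for all $x,y\in e$. The tension graph of $f$ is the union of the edges $e$ with $s_e=\mathrm{Lip}(f)$. The gates of $f$ are the classes of the minimal $G$-invariant family of equivalence relations on the sets of oriented edges with a given origin for which two edges $e,e'$ with the same origin are equivalent whenever $f(e)\cap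 f(e')$ is not reduced to a point. The map $f$ is optimal if $\mathrm{Lip}(f)=\mathrm{Lip}(T,S)$ and if at every vertex of its tension graph there are at least two gates that contain edges of the tension graph. Lemma. Let $G$ be a non-solvable GBS group with cyclic deformation space $\mathcal D$, let $T,S$ be trees in $\mathcal D$, scaled so that $\mathrm{vol}(T/G)=\mathrm{vol}(S/G)=1$, and let $D\ge 1$ be a real number such that $\max\{\mathrm{Lip}(T,S),\mathrm{Lip}(S,T)\}\le D$. Then every optimal map $\tau:T\to S$ is a $G$-equivariant $(D,4D)$-quasi-isometry: $\tau$ is $G$-equivariant, for all $x,y\in T$ \[ \frac1D\, d_T(x,y)-4D\;\le\; d_S(\tau(x),\tau(y))\;\le\; D\, d_T(x,y)+4D, \] and every point of $S$ is at distance at most $4D$ from $\tau(T)$. -/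

import Mathlib

open scoped ENNReal NNReal

namespace GBS

/-! ## Graphs of groups and generalized Baumslag-Solitar groups -/

/-- A graph of groups. The graph is given together with an orientation: `E` is the set of positively
oriented edges, an edge `e` goes from `o e` to `t e`. Each edge group embeds in the vertex groups at
both ends of the edge. -/
structure GraphOfGroups where
  V : Type
  E : Type
  o : E → V
  t : E → V
  vertexGroup : V → Type
  edgeGroup : E → Type
  [vGroup : ∀ v, Group (vertexGroup v)]
  [eGroup : ∀ e, Group (edgeGroup e)]
  toInitial : ∀ e, edgeGroup e →* vertexGroup (o e)
  toTerminal : ∀ e, edgeGroup e →* vertexGroup (t e)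
  toInitial_injective : ∀ e, Function.Injective (toInitial e)
  toTerminal_injective : ∀ e, Function.Injective (toTerminal e)

attribute [instance] GraphOfGroups.vGroup GraphOfGroups.eGroup

namespace GraphOfGroups

variable (Γ : GraphOfGroups)

/-- `v` and `w` are joined by an (unoriented) edge path all of whose edges lie in `A`. -/
def Joined (A : Set Γ.E) (v w : Γ.V) : Prop :=
  Relation.EqvGen (fun a b => ∃ e ∈ A, Γ.o e = a ∧ Γ.t e = b) v w

/-- `A` is the edge set of a maximal subtree: it connects all the vertices, and it contains no
cycle, i.e. each of its edges is a bridge. -/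
def IsMaximalSubtree (A : Set Γ.E) : Prop :=
  (∀ v w, Γ.Joined A v w) ∧ ∀ e ∈ A, ¬ Γ.Joined (A \ {e}) (Γ.o e) (Γ.t e)

/-- The free product of all the vertex groups and of the free group on the edges. -/
abbrev BigFreeProduct : Type :=
  Monoid.Coprod (Monoid.CoprodI Γ.vertexGroup) (FreeGroup Γ.E)

/-- An element of a vertex group, as an element of the free product. -/
def ofVertex (v : Γ.V) (x : Γ.vertexGroup v) : Γ.BigFreeProduct :=
  Monoid.Coprod.inl (Monoid.CoprodI.of x)

/-- The stable letter of an edge. -/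
def stableLetter (e : Γ.E) : Γ.BigFreeProduct :=
  Monoid.Coprod.inr (FreeGroup.of e)

/-- The relators `t_e x t_e⁻¹ y⁻¹`, where `x` and `y` are the images in the terminal and the initial
vertex group of the same element of the edge group, and `t_e` for `e` in the maximal subtree. -/
def relators (A : Set Γ.E) : Set Γ.BigFreeProduct :=
  {r | ∃ (e : Γ.E) (h : Γ.edgeGroup e),
      r = Γ.stableLetter e * Γ.ofVertex (Γ.t e) (Γ.toTerminal e h) * (Γ.stableLetter e)⁻¹ *
        (Γ.ofVertex (Γ.o e) (Γ.toInitial e h))⁻¹} ∪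
  {r | ∃ e ∈ A, r = Γ.stableLetter e}

/-- The fundamental group of a graph of groups with respect to a maximal subtree. -/
abbrev FundamentalGroup (A : Set Γ.E) : Type :=
  Γ.BigFreeProduct ⧸ Subgroup.normalClosure (Γ.relators A)

end GraphOfGroups

/-- `G` is a generalized Baumslag-Solitar group: it is isomorphic to the fundamental group of a
finite (connected) graph of groups all of whose vertex and edge groups are infinite cyclic. -/
def IsGBS (G : Type*) [Group G] : Prop :=
  ∃ (Γ : GraphOfGroups) (A : Set Γ.E),
    Finite Γ.V ∧ Finite Γ.E ∧ Nonempty Γ.V ∧ Γ.IsMaximalSubtree A ∧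
    (∀ v, IsCyclic (Γ.vertexGroup v) ∧ Infinite (Γ.vertexGroup v)) ∧
    (∀ e, IsCyclic (Γ.edgeGroup e) ∧ Infinite (Γ.edgeGroup e)) ∧
    Nonempty (G ≃* Γ.FundamentalGroup A)

/-! ## Metric simplicial trees -/

section Trees

variable {X : Type*} [MetricSpace X]

/-- The metric segment `[x, y]`. -/
def seg (x y : X) : Set X := {z | dist x z + dist z y = dist x y}

/-- `X` is a real tree: a geodesic metric space which is `0`-hyperbolic (four point condition). -/
structure IsRealTree (X : Type*) [MetricSpace X] : Prop where
  geodesic : ∀ x y : X, ∃ γ : ℝ → X, γ 0 = x ∧ γ (dist x y) = y ∧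
    ∀ s ∈ Set.Icc 0 (dist x y), ∀ t ∈ Set.Icc 0 (dist x y), dist (γ s) (γ t) = |s - t|
  fourPoint : ∀ x y z w : X,
    dist x y + dist z w ≤ max (dist x z + dist y w) (dist x w + dist y z)

/-- `v` and `w` are the two ends of an edge, for the vertex set `V`. -/
def IsEdge (V : Set X) (v w : X) : Prop :=
  v ∈ V ∧ w ∈ V ∧ v ≠ w ∧ seg v w ∩ V = {v, w}

/-- `X` with the vertex set `V` is a metric simplicial tree (the geometric realization, with the
path metric, of a nonempty combinatorial tree whose edges have positive lengths): a real tree in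
which every point lies between two vertices, every segment has finitely many vertices, and the
interior of every edge is open, so that branching occurs at vertices only. -/
structure IsSimplicialTree (V : Set X) : Prop where
  nonempty : V.Nonempty
  realTree : IsRealTree X
  finite_inter : ∀ x y : X, (seg x y ∩ V).Finite
  cover : ∀ x : X, ∃ v ∈ V, ∃ w ∈ V, x ∈ seg v w
  isOpen_interior : ∀ v w : X, IsEdge V v w → IsOpen (seg v w \ {v, w})

end Trees

/-- A `G`-tree: a metric simplicial tree with an action of `G` by isometries that preserves the
simplicial structure and does not invert edges. -/
structure GTree (G : Type*) [Group G] where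
  carrier : Type*
  [metric : MetricSpace carrier]
  [action : MulAction G carrier]
  [isometric : IsIsometricSMul G carrier]
  verts : Set carrier
  isTree : IsSimplicialTree verts
  smul_mem : ∀ (g : G) (v : carrier), v ∈ verts → g • v ∈ verts
  no_inversion : ∀ (g : G) (v w : carrier), IsEdge verts v w → ¬ (g • v = w ∧ g • w = v)

attribute [instance] GTree.metric GTree.action GTree.isometric

namespace GTree

variable {G : Type*} [Group G]

instance : CoeSort (GTree G) (Type _) := ⟨GTree.carrier⟩

variable (T : GTree G)

/-- An oriented edge, given by its origin and its end. -/
@[ext] structure OrientedEdge where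
  src : T
  tgt : T
  isEdge : IsEdge T.verts src tgt

theorem smul_mem_iff (g : G) (v : T) : g • v ∈ T.verts ↔ v ∈ T.verts :=
  ⟨fun h => by simpa using T.smul_mem g⁻¹ _ h, T.smul_mem g v⟩

theorem isEdge_smul (g : G) {v w : T} (h : IsEdge T.verts v w) :
    IsEdge T.verts (g • v) (g • w) := by
  obtain ⟨hv, hw, hne, hs⟩ := h
  refine ⟨T.smul_mem g v hv, T.smul_mem g w hw, fun h => hne (MulAction.injective g h), ?_⟩
  ext z
  have hz := Set.ext_iff.1 hs (g⁻¹ • z)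
  have h1 : dist (g • v) z = dist v (g⁻¹ • z) := by
    rw [← dist_smul g v (g⁻¹ • z), smul_inv_smul]
  have h2 : dist z (g • w) = dist (g⁻¹ • z) w := by
    rw [← dist_smul g (g⁻¹ • z) w, smul_inv_smul]
  simp only [seg, Set.mem_inter_iff, Set.mem_ofPred_eq, Set.mem_insert_iff,
    Set.mem_singleton_iff, T.smul_mem_iff, inv_smul_eq_iff] at hz
  simpa only [seg, Set.mem_inter_iff, Set.mem_ofPred_eq, Set.mem_insert_iff,
    Set.mem_singleton_iff, dist_smul, h1, h2] using hz

variable {T} in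
/-- The translate of an oriented edge. -/
def OrientedEdge.translate (g : G) (e : T.OrientedEdge) : T.OrientedEdge :=
  ⟨g • e.src, g • e.tgt, T.isEdge_smul g e.isEdge⟩

variable {T} in
/-- The set of points of an edge. -/
def OrientedEdge.points (e : T.OrientedEdge) : Set T := seg e.src e.tgt

variable {T} in
/-- The length of an edge. -/
noncomputable def OrientedEdge.length (e : T.OrientedEdge) : ℝ := dist e.src e.tgt

/-- Two oriented edges are related when they define the same edge of the quotient graph, up to
orientation. -/
def edgeOrbit : Setoid T.OrientedEdge where
  r e f := ∃ g : G, (g • e.src = f.src ∧ g • e.tgt = f.tgt) ∨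
    (g • e.src = f.tgt ∧ g • e.tgt = f.src)
  iseqv := by
    refine ⟨fun e => ⟨1, by simp⟩, ?_, ?_⟩
    · rintro e f ⟨g, ⟨h1, h2⟩ | ⟨h1, h2⟩⟩
      · exact ⟨g⁻¹, Or.inl ⟨by simp [← h1], by simp [← h2]⟩⟩
      · exact ⟨g⁻¹, Or.inr ⟨by simp [← h2], by simp [← h1]⟩⟩
    · rintro e f k ⟨g, ⟨h1, h2⟩ | ⟨h1, h2⟩⟩ ⟨g', ⟨h3, h4⟩ | ⟨h3, h4⟩⟩
      · exact ⟨g' * g, Or.inl ⟨by rw [mul_smul, h1, h3], by rw [mul_smul, h2, h4]⟩⟩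
      · exact ⟨g' * g, Or.inr ⟨by rw [mul_smul, h1, h3], by rw [mul_smul, h2, h4]⟩⟩
      · exact ⟨g' * g, Or.inr ⟨by rw [mul_smul, h1, h4], by rw [mul_smul, h2, h3]⟩⟩
      · exact ⟨g' * g, Or.inl ⟨by rw [mul_smul, h1, h4], by rw [mul_smul, h2, h3]⟩⟩

/-- The length of an unoriented edge of the quotient graph. -/
noncomputable def quotientLength : Quotient T.edgeOrbit → ℝ≥0∞ :=
  Quotient.lift (fun e : T.OrientedEdge => ENNReal.ofReal e.length) (by
    rintro e f ⟨g, ⟨h1, h2⟩ | ⟨h1, h2⟩⟩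
    · simp only [OrientedEdge.length]
      rw [← h1, ← h2, dist_smul]
    · simp only [OrientedEdge.length]
      rw [← h1, ← h2, dist_smul, dist_comm])

/-- The volume of the quotient graph `T / G`: the sum of the lengths of its (unoriented) edges. -/
noncomputable def vol : ℝ≥0∞ := ∑' q : Quotient T.edgeOrbit, T.quotientLength q

/-- `Y` is a subtree, i.e. a nonempty connected union of vertices and edges. -/
def IsSubtree (Y : Set T) : Prop :=
  Y.Nonempty ∧ (∀ x ∈ Y, ∀ y ∈ Y, seg x y ⊆ Y) ∧
    ∀ x ∈ Y, ∃ v ∈ Y ∩ T.verts, ∃ w ∈ Y ∩ T.verts, x ∈ seg v w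

/-- There is no proper `G`-invariant subtree. -/
def IsMinimal : Prop :=
  ∀ Y : Set T, T.IsSubtree Y → (∀ (g : G), ∀ x ∈ Y, g • x ∈ Y) → Y = Set.univ

/-- `T` is (a representative of a point) in the cyclic deformation space of `G`: it is minimal, and
its vertex and edge stabilizers are cyclic. -/
structure InCyclicDeformationSpace : Prop where
  minimal : T.IsMinimal
  vertex_stabilizer : ∀ v ∈ T.verts, IsCyclic (MulAction.stabilizer G v)
  edge_stabilizer : ∀ e : T.OrientedEdge,
    IsCyclic (MulAction.stabilizer G e.src ⊓ MulAction.stabilizer G e.tgt : Subgroup G)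

end GTree

/-! ## Equivariant maps, Lipschitz constants, optimal maps -/

/-- The Lipschitz constant of a map, which is `∞` if the map is not Lipschitz. -/
noncomputable def lipConst {X Y : Type*} [MetricSpace X] [MetricSpace Y] (f : X → Y) : ℝ≥0∞ :=
  ⨅ (K : ℝ≥0) (_ : LipschitzWith K f), (K : ℝ≥0∞)

/-- `f` is a `(K, C)`-quasi-isometry. -/
structure IsQuasiIsometry {X Y : Type*} [MetricSpace X] [MetricSpace Y] (K C : ℝ) (f : X → Y) :
    Prop where
  lower : ∀ x y, K⁻¹ * dist x y - C ≤ dist (f x) (f y)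
  upper : ∀ x y, dist (f x) (f y) ≤ K * dist x y + C
  coarselySurjective : ∀ z, ∃ x, dist z (f x) ≤ C

variable {G : Type*} [Group G]

/-- `f : T → S` commutes with the actions of `G`. -/
def Equivariant (T S : GTree G) (f : T → S) : Prop := ∀ (g : G) (x : T), f (g • x) = g • f x

/-- `Lip(T, S)`, the infimum of the Lipschitz constants of the equivariant maps `T → S`. Maps that
are not Lipschitz contribute `∞` to the infimum. -/
noncomputable def Lip (T S : GTree G) : ℝ≥0∞ :=
  ⨅ (f : T → S) (_ : Equivariant T S f), lipConst f

/-- `f` is linear on the edge `e` with stretch factor `s`: it maps `e` onto a segment at constant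
speed `s`. -/
def HasStretch (T S : GTree G) (f : T → S) (e : T.OrientedEdge) (s : ℝ≥0) : Prop :=
  ∀ x ∈ e.points, ∀ y ∈ e.points, dist (f x) (f y) = s * dist x y

/-- A gate structure on `T`: a `G`-invariant family of equivalence relations on the sets of edges
with a given origin, encoded as one equivalence relation that only relates edges with the same
origin. -/
structure GateStructure (T : GTree G) extends Setoid T.OrientedEdge where
  same_src : ∀ e e', r e e' → e.src = e'.src
  invariant : ∀ (g : G) e e', r e e' → r (e.translate g) (e'.translate g)

/-- `e` and `e'` have the same origin and are in the same gate of the gate structure induced by `f`,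
i.e. the minimal gate structure that relates any two edges with the same origin whose images overlap
in a nondegenerate segment. -/
def SameGate (T S : GTree G) (f : T → S) (e e' : T.OrientedEdge) : Prop :=
  ∀ R : GateStructure T,
    (∀ a b : T.OrientedEdge, a.src = b.src → (f '' a.points ∩ f '' b.points).Nontrivial →
      R.r a b) → R.r e e'

/-- The edge `e` belongs to the tension graph of `f`: its stretch factor is the Lipschitz constant
of `f`. -/
def IsTensionEdge (T S : GTree G) (f : T → S) (e : T.OrientedEdge) : Prop :=
  ∃ s : ℝ≥0, HasStretch T S f e s ∧ (s : ℝ≥0∞) = lipConst f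

/-- The map `f : T → S` is optimal: it is equivariant, linear on edges, its Lipschitz constant is
`Lip(T, S)`, and at every vertex of its tension graph there are at least two gates, for the gate
structure induced by `f`, that contain edges of the tension graph. -/
structure IsOptimal (T S : GTree G) (f : T → S) : Prop where
  equivariant : Equivariant T S f
  linear : ∀ e : T.OrientedEdge, ∃ s : ℝ≥0, HasStretch T S f e s
  lip_eq : lipConst f = Lip T S
  two_gates : ∀ v : T, (∃ e, IsTensionEdge T S f e ∧ (e.src = v ∨ e.tgt = v)) →
    ∃ e e' : T.OrientedEdge, e.src = v ∧ e'.src = v ∧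
      IsTensionEdge T S f e ∧ IsTensionEdge T S f e' ∧ ¬ SameGate T S f e e'

end GBS

namespace GBS

open Filter

/-! ## Segments of a real tree -/

section RealTree

variable {X : Type*} [MetricSpace X]

/-! The upper bound is immediate: an optimal map realizes `Lip T S`, so `τ` is `D`-Lipschitz.

For the lower bound, `D`-Lipschitz equivariant maps (up to `ε`) from `S` back to `T` only control
displacements of group elements: if `g` moves every point of `T` by at least `c`, it moves every
point of `S` by at least `c / D`. So the distance between two vertices `v ≠ w` of `T` has to be read
off from a displacement. `exists_displacement` finds `g` that moves every point by at least `dist v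
w` and satisfies `dist w (g • v) ≤ 2`; then `τ v` and `g • τ v` are at least `dist v w / D` apart,
while `τ w` is within `2 * D` of `g • τ v`.

To get `g`, a translate of the first edge of `[v, w]` must lie beyond the last edge, oriented the
same way. If no translate did, all translates of a certain ray would point to one end of `T`. The
Busemann function of that end would give a homomorphism to `ℝ` whose kernel is abelian, since any
two of its elements share a cyclic stabilizer, and `G` would be solvable (`isSolvable_of_busemann`,
`exists_coherent`). The gap is made at most `2` by taking a shortest reduced path in the orbit: its
interior edges lie in distinct oriented orbits, so their total length is at most twice the volume.

Coarse surjectivity comes from minimality of `S`, which is the convex hull of any vertex orbit. -/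

theorem mem_seg_iff {x y z : X} : z ∈ seg x y ↔ dist x z + dist z y = dist x y := Iff.rfl

theorem mem_seg_of_le {x y z : X} (h : dist x z + dist z y ≤ dist x y) : z ∈ seg x y :=
  le_antisymm h (dist_triangle x z y)

theorem left_mem_seg (x y : X) : x ∈ seg x y := by simp [mem_seg_iff]

theorem right_mem_seg (x y : X) : y ∈ seg x y := by simp [mem_seg_iff]

theorem mem_seg_comm {x y z : X} : z ∈ seg x y ↔ z ∈ seg y x := by
  rw [mem_seg_iff, mem_seg_iff, dist_comm x z, dist_comm z y, dist_comm x y, add_comm]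

theorem mem_seg_of_mem_right {a b c d : X} (h : b ∈ seg a c) (h' : d ∈ seg b c) :
    d ∈ seg a c ∧ b ∈ seg a d := by
  simp only [mem_seg_iff] at *
  have h1 := dist_triangle a b d
  have h2 := dist_triangle a d c
  constructor <;> linarith

theorem mem_seg_of_mem_left {a b c d : X} (h : b ∈ seg a c) (h' : d ∈ seg a b) :
    d ∈ seg a c ∧ b ∈ seg d c := by
  simp only [mem_seg_iff] at *
  have h1 := dist_triangle d b c
  have h2 := dist_triangle a d c
  constructor <;> linarith

theorem smul_mem_seg_iff {G : Type*} [Group G] [MulAction G X] [IsIsometricSMul G X] (g : G)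
    {x y z : X} : g • z ∈ seg (g • x) (g • y) ↔ z ∈ seg x y := by
  simp only [mem_seg_iff, dist_smul]

namespace IsRealTree

/-- Local geodesics are geodesics. The overlap `[q, r]` must be nondegenerate: for `q = r` the path
could backtrack. -/
theorem mem_seg_trans (hX : IsRealTree X) {p q r s : X} (h : q ∈ seg p r) (h' : r ∈ seg q s)
    (hne : q ≠ r) :
    r ∈ seg p s := by
  have h4 := hX.fourPoint p r q s
  have hpos := dist_pos.2 hne
  rw [mem_seg_iff] at *
  have h1 := dist_triangle p r s
  rcases le_max_iff.1 h4 with h | h <;> rw [dist_comm r q] at * <;> linarith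

theorem dist_eq_of_mem_seg (hX : IsRealTree X) {p q r s : X} (h : q ∈ seg p r)
    (h' : r ∈ seg q s) (hne : q ≠ r) :
    dist p s = dist p q + dist q r + dist r s := by
  have := hX.mem_seg_trans h h' hne
  rw [mem_seg_iff] at *
  linarith

/-- A point of `[a, c]` cannot be bypassed on the way from `x` to both ends. This is the main tool
for case distinctions below. -/
theorem mem_seg_or (hX : IsRealTree X) {a b c : X} (h : b ∈ seg a c) (x : X) :
    b ∈ seg x a ∨ b ∈ seg x c := by
  have h4 := hX.fourPoint x b a c
  rw [mem_seg_iff] at *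
  have h1 := dist_triangle x b a
  have h2 := dist_triangle x b c
  rw [dist_comm a b] at h
  rcases le_max_iff.1 h4 with h' | h' <;> [left; right] <;>
    simp only [mem_seg_iff, dist_comm] at * <;> linarith

/-- Three points of a real tree have a median. -/
theorem exists_median (hX : IsRealTree X) (x y z : X) :
    ∃ c, c ∈ seg x y ∧ c ∈ seg x z ∧ c ∈ seg y z := by
  obtain ⟨γ, h0, h1, hγ⟩ := hX.geodesic x y
  -- The Gromov product of `y` and `z` at `x`: the median lies at this distance from `x`.
  set r := (dist x y + dist x z - dist y z) / 2 with hr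
  have t1 := dist_triangle y x z
  have t2 := dist_triangle x y z
  have t3 := dist_triangle x z y
  have e1 := dist_comm x y
  have e2 := dist_comm z y
  have hd : 0 ≤ dist x y := dist_nonneg
  have hr0 : r ∈ Set.Icc 0 (dist x y) := ⟨by linarith, by linarith⟩
  have a1 : dist x (γ r) = r := by
    rw [← h0, hγ 0 ⟨le_rfl, hd⟩ r hr0, zero_sub, abs_neg, abs_of_nonneg hr0.1]
  have a2 : dist (γ r) y = dist x y - r := by
    have := hγ r hr0 (dist x y) ⟨hd, le_rfl⟩
    rw [h1, abs_sub_comm, abs_of_nonneg (by linarith [hr0.2])] at this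
    exact this
  have h4 := hX.fourPoint (γ r) z x y
  have e3 := dist_comm (γ r) x
  have e4 := dist_comm (γ r) y
  have e5 := dist_comm z x
  have e6 := dist_comm z (γ r)
  have hc : dist (γ r) z ≤ dist x z - r := by
    rcases le_max_iff.1 h4 with h | h <;> linarith
  refine ⟨γ r, mem_seg_of_le (by linarith), mem_seg_of_le (by linarith), mem_seg_of_le ?_⟩
  linarith

/-- A lower bound for the displacement of an isometry. -/
theorem dist_sub_le_dist_smul (hX : IsRealTree X) {G : Type*} [Group G] [MulAction G X]
    [IsIsometricSMul G X]
    (g : G) (x z : X) : dist x (g • g • x) - dist x (g • x) ≤ dist z (g • z) := by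
  -- With `g • z` as fourth point, `dist x z` occurs on both sides and cancels.
  have h4 := hX.fourPoint x (g • g • x) (g • x) (g • z)
  have e1 : dist (g • x) (g • z) = dist x z := dist_smul g x z
  have e2 : dist (g • g • x) (g • z) = dist (g • x) z := dist_smul g (g • x) z
  have e3 : dist (g • g • x) (g • x) = dist x (g • x) := by
    rw [dist_smul, dist_comm]
  have t1 := dist_triangle (g • x) (g • z) z
  have t2 := dist_triangle x z (g • z)
  have e4 := dist_comm (g • z) z
  have e5 := dist_comm (g • x) (g • g • x)
  rcases le_max_iff.1 h4 with h | h <;> linarith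

end IsRealTree

/-! ## Rays -/

/-- `a` is a geodesic ray with steps of length `l`. -/
structure IsRay (a : ℕ → X) (l : ℝ) : Prop where
  pos : 0 < l
  dist_succ : ∀ n, dist (a n) (a (n + 1)) = l
  mem_seg : ∀ n, a (n + 1) ∈ seg (a n) (a (n + 2))

namespace IsRay

variable {a : ℕ → X} {l : ℝ}

theorem ne (ha : IsRay a l) (n : ℕ) : a n ≠ a (n + 1) :=
  dist_pos.1 (by rw [ha.dist_succ]; exact ha.pos)

theorem dist_le (ha : IsRay a l) (m : ℕ) : dist (a 0) (a m) ≤ m * l := by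
  have := dist_le_range_sum_dist a m
  simpa [ha.dist_succ] using this

theorem smul {G : Type*} [Group G] [MulAction G X] [IsIsometricSMul G X] (g : G)
    (ha : IsRay a l) : IsRay (fun n => g • a n) l :=
  ⟨ha.pos, fun n => by simp only [dist_smul, ha.dist_succ],
    fun n => (smul_mem_seg_iff g).2 (ha.mem_seg n)⟩

theorem eventually_mem_seg (hX : IsRealTree X) (ha : IsRay a l) (x : X) :
    ∀ᶠ n in atTop, a n ∈ seg x (a (n + 1)) := by
  have key : ∃ N, a N ∈ seg x (a (N + 1)) := by
    -- Otherwise every step of the ray would approach `x` by `l`, and the distance to `x` would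
    -- become negative.
    by_contra! hcon
    have hdist : ∀ n : ℕ, dist x (a n) = dist x (a 0) - n * l := by
      intro n
      induction n with
      | zero => simp
      | succ n ih =>
        rcases hX.mem_seg_or (ha.mem_seg n) x with h | h
        · have h1 := ha.dist_succ n
          rw [mem_seg_iff, dist_comm (a (n + 1))] at h
          push_cast
          linarith
        · exact absurd h (hcon (n + 1))
    obtain ⟨n, hn⟩ := exists_nat_gt (dist x (a 0) / l)
    rw [div_lt_iff₀ ha.pos] at hn
    have := hdist n
    have h0 : 0 ≤ dist x (a n) := dist_nonneg
    linarith
  obtain ⟨N, hN⟩ := key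
  filter_upwards [eventually_ge_atTop N] with n hn
  induction n, hn using Nat.le_induction with
  | base => exact hN
  | succ n _ ih => exact hX.mem_seg_trans ih (ha.mem_seg n) (ha.ne n)

/-- The Busemann function of a ray. -/
theorem exists_busemann (hX : IsRealTree X) (ha : IsRay a l) :
    ∃ B : X → ℝ, ∀ x, ∀ᶠ n : ℕ in atTop, dist x (a n) = B x + n * l := by
  have : ∀ x, ∃ c : ℝ, ∀ᶠ n : ℕ in atTop, dist x (a n) = c + n * l := by
    intro x
    obtain ⟨N, hN⟩ := eventually_atTop.1 (ha.eventually_mem_seg hX x)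
    refine ⟨dist x (a N) - N * l, ?_⟩
    filter_upwards [eventually_ge_atTop N] with n hn
    induction n, hn using Nat.le_induction with
    | base => ring
    | succ n hn ih =>
      have h1 := hN n hn
      have h2 := ha.dist_succ n
      rw [mem_seg_iff] at h1
      push_cast
      linarith
  exact ⟨fun x => (this x).choose, fun x => (this x).choose_spec⟩

end IsRay

/-! ## Vertices and edges of a simplicial tree -/

namespace IsEdge

variable {V : Set X} {u v : X}

theorem symm (h : IsEdge V u v) : IsEdge V v u := by
  obtain ⟨hu, hv, hne, hs⟩ := h
  refine ⟨hv, hu, hne.symm, ?_⟩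
  rw [Set.pair_comm, ← hs]
  ext z
  simp only [Set.mem_inter_iff, mem_seg_comm]

end IsEdge

namespace IsSimplicialTree

variable {V : Set X}

/-- Every vertex lies on one of the two sides of an edge. -/
theorem mem_seg_or_of_isEdge (hV : IsSimplicialTree V) {u v x : X} (he : IsEdge V u v)
    (hx : x ∈ V) :
    v ∈ seg u x ∨ u ∈ seg v x := by
  obtain ⟨c, huv, hux, hvx⟩ := hV.realTree.exists_median u v x
  by_cases hcv : c = v
  · exact Or.inl (hcv ▸ hux)
  by_cases hcu : c = u
  · exact Or.inr (hcu ▸ hvx)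
  exfalso
  by_cases hcx : c = x
  · have hm : c ∈ seg u v ∩ V := ⟨huv, hcx ▸ hx⟩
    rw [he.2.2.2] at hm
    rcases hm with h | h
    exacts [hcu h, hcv h]
  -- The median `c` would be a branch point inside the edge. As the interior is open, a point
  -- slightly beyond `c` towards `x` is still on `[u, v]`, although it is reached from both `u` and
  -- `v` through `c`.
  obtain ⟨ε, hε, hball⟩ := Metric.isOpen_iff.1 (hV.isOpen_interior u v he) c
    ⟨huv, by simp [hcu, hcv]⟩
  obtain ⟨γ, h0, h1, hγ⟩ := hV.realTree.geodesic c x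
  have hpos := dist_pos.2 hcx
  set t := min (ε / 2) (dist c x) with ht
  have ht0 : 0 < t := lt_min (by linarith) hpos
  have htI : t ∈ Set.Icc 0 (dist c x) := ⟨ht0.le, min_le_right _ _⟩
  have a1 : dist c (γ t) = t := by
    rw [← h0, hγ 0 ⟨le_rfl, hpos.le⟩ t htI, zero_sub, abs_neg, abs_of_pos ht0]
  have a2 : dist (γ t) x = dist c x - t := by
    have := hγ t htI (dist c x) ⟨hpos.le, le_rfl⟩
    rw [h1, abs_sub_comm, abs_of_nonneg (by linarith [htI.2])] at this
    exact this
  have hseg : γ t ∈ seg c x := mem_seg_of_le (by linarith)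
  have hin : γ t ∈ Metric.ball c ε := by
    rw [Metric.mem_ball, dist_comm, a1]
    have := min_le_left (ε / 2) (dist c x)
    linarith
  have b1 := (hball hin).1
  have b2 := (mem_seg_of_mem_right hux hseg).2
  have b3 := (mem_seg_of_mem_right hvx hseg).2
  rw [mem_seg_iff] at b1 b2 b3 huv
  rw [dist_comm c v] at huv
  rw [dist_comm (γ t) v] at b1
  linarith

/-- The first edge of a segment that starts at a vertex. -/
theorem exists_isEdge_left (hV : IsSimplicialTree V) {v w : X} (hv : v ∈ V) (hw : w ∈ V)
    (hne : v ≠ w) :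
    ∃ c ∈ seg v w, IsEdge V v c := by
  have hfin : ((seg v w ∩ V) \ {v}).Finite := (hV.finite_inter v w).sdiff
  obtain ⟨c, ⟨⟨hc, hcV⟩, hcv⟩, hmin⟩ := Set.exists_min_image _ (fun c => dist v c) hfin
    ⟨w, ⟨right_mem_seg v w, hw⟩, fun h => hne h.symm⟩
  refine ⟨c, hc, hv, hcV, fun h => hcv h.symm, ?_⟩
  apply Set.Subset.antisymm
  · rintro z ⟨hz, hzV⟩
    by_cases hzv : z = v
    · exact Or.inl hzv
    right
    have := hmin z ⟨⟨(mem_seg_of_mem_left hc hz).1, hzV⟩, hzv⟩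
    rw [mem_seg_iff] at hz
    exact dist_le_zero.1 (by linarith)
  · rintro z (rfl | rfl)
    · exact ⟨left_mem_seg _ _, hv⟩
    · exact ⟨right_mem_seg _ _, hcV⟩

/-- Every point is a vertex or belongs to an edge. -/
theorem exists_isEdge_mem_seg (hV : IsSimplicialTree V) {x : X} (hx : x ∉ V) :
    ∃ c d, IsEdge V c d ∧ x ∈ seg c d := by
  obtain ⟨v, hv, w, hw, hxs⟩ := hV.cover x
  obtain ⟨c, ⟨hc, hcV⟩, hcmin⟩ := Set.exists_min_image _ (fun c => dist c x)
    (hV.finite_inter v x) ⟨v, left_mem_seg _ _, hv⟩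
  obtain ⟨d, ⟨hd, hdV⟩, hdmin⟩ := Set.exists_min_image _ (fun d => dist x d)
    (hV.finite_inter x w) ⟨w, right_mem_seg _ _, hw⟩
  have hcx : x ∈ seg c w := (mem_seg_of_mem_left hxs hc).2
  have hcd : x ∈ seg c d := (mem_seg_of_mem_right hcx hd).2
  have hdc : d ∈ seg c w := (mem_seg_of_mem_right hcx hd).1
  refine ⟨c, d, ⟨hcV, hdV, ?_, ?_⟩, hcd⟩
  · rintro rfl
    rw [mem_seg_iff, dist_self, dist_comm x c] at hcd
    have h0 : 0 ≤ dist c x := dist_nonneg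
    exact hx (dist_le_zero.1 (show dist c x ≤ 0 by linarith) ▸ hcV)
  apply Set.Subset.antisymm
  · rintro z ⟨hz, hzV⟩
    rcases hV.realTree.mem_seg_or hcd z with h | h
    · right
      rw [mem_seg_comm] at h
      have hxz : z ∈ seg x d := by
        rw [mem_seg_iff] at *
        linarith
      have := hdmin z ⟨(mem_seg_of_mem_left hd hxz).1, hzV⟩
      rw [mem_seg_iff] at hxz
      exact dist_le_zero.1 (by linarith)
    · left
      have hzx : z ∈ seg c x := by
        rw [mem_seg_iff] at *
        linarith
      have := hcmin z ⟨(mem_seg_of_mem_right hc hzx).1, hzV⟩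
      rw [mem_seg_iff] at hzx
      have h0 : dist c z ≤ 0 := by linarith
      exact (dist_le_zero.1 h0).symm
  · rintro z (rfl | rfl)
    · exact ⟨left_mem_seg _ _, hcV⟩
    · exact ⟨right_mem_seg _ _, hdV⟩

end IsSimplicialTree

end RealTree

/-! ## Coherently oriented edges -/

section Coherent

variable {X : Type*} [MetricSpace X]

/-- The points `u`, `v`, `w`, `z` lie on a segment in this order. -/
def Coherent (u v w z : X) : Prop := dist u z = dist u v + dist v w + dist w z

theorem Coherent.symm {u v w z : X} (h : Coherent u v w z) : Coherent z w v u := by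
  unfold Coherent at *
  rw [dist_comm z u, dist_comm z w, dist_comm w v, dist_comm v u]
  linarith

theorem coherent_of_mem_seg {u v w z : X} (h : v ∈ seg u w) (h' : w ∈ seg u z) :
    Coherent u v w z := by
  simp only [mem_seg_iff, Coherent] at *
  linarith

theorem Coherent.left_mem {u v w z : X} (h : Coherent u v w z) : v ∈ seg u z ∧ v ∈ seg u w := by
  unfold Coherent at h
  have h1 := dist_triangle v w z
  have h2 := dist_triangle u w z
  constructor <;> apply mem_seg_of_le <;> linarith

theorem Coherent.right_mem {u v w z : X} (h : Coherent u v w z) :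
    w ∈ seg u z ∧ w ∈ seg v z := by
  unfold Coherent at h
  have h1 := dist_triangle u v w
  have h2 := dist_triangle u v z
  constructor <;> apply mem_seg_of_le <;> linarith

theorem coherent_smul_iff {G : Type*} [Group G] [MulAction G X] [IsIsometricSMul G X] (g : G)
    {u v w z : X} : Coherent (g • u) (g • v) (g • w) (g • z) ↔ Coherent u v w z := by
  simp only [Coherent, dist_smul]

theorem Coherent.trans (hX : IsRealTree X) {u v w z p q : X} (h : Coherent u v w z)
    (h' : Coherent w z p q) (hne : w ≠ z) : Coherent u v p q := by
  have h1 := hX.mem_seg_trans h.right_mem.1 h'.left_mem.1 hne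
  have h2 := h.left_mem.1
  have h3 := h'.right_mem.2
  have t1 := dist_triangle v z p
  have t2 := dist_triangle u v p
  have t3 := dist_triangle u p q
  unfold Coherent
  rw [mem_seg_iff] at h1 h2 h3
  linarith

end Coherent

/-! ### Minimal trees: hyperbolic elements, fixed ends and solvability -/

namespace GTree

variable {G : Type*} [Group G] (T : GTree G)

theorem isRealTree : IsRealTree T := T.isTree.realTree

variable {T}

/-- In a minimal tree, the convex hull of any orbit of vertices is everything. -/
theorem IsMinimal.exists_mem_seg_smul (hT : T.IsMinimal) {p : T} (hp : p ∈ T.verts) (x : T) :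
    ∃ g h : G, x ∈ seg (g • p) (h • p) := by
  have key := hT {x | ∃ g h : G, x ∈ seg (g • p) (h • p)} ⟨⟨p, 1, 1, ?_⟩, ?_, ?_⟩ ?_
  · exact (Set.ext_iff.1 key x).2 trivial
  · simpa using left_mem_seg p p
  · rintro x ⟨a, b, hx⟩ y ⟨c, d, hy⟩ z hz
    -- Once one end of the segment is an orbit point, `mem_seg_or` replaces the other by an orbit
    -- point; this is done for `y` here and for `x` below.
    have main : ∀ t : G, z ∈ seg (t • p) y → ∃ g h : G, z ∈ seg (g • p) (h • p) := by
      intro t ht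
      rcases T.isRealTree.mem_seg_or hy (t • p) with h | h
      · rw [mem_seg_comm] at ht
        exact ⟨t, c, (mem_seg_of_mem_left h (mem_seg_comm.1 ht)).1⟩
      · exact ⟨t, d, (mem_seg_of_mem_left h ht).1⟩
    rcases T.isRealTree.mem_seg_or hx y with h | h
    · exact main a (mem_seg_comm.1 (mem_seg_of_mem_left h (mem_seg_comm.1 hz)).1)
    · exact main b (mem_seg_comm.1 (mem_seg_of_mem_left h (mem_seg_comm.1 hz)).1)
  · rintro x ⟨a, b, hx⟩
    exact ⟨a • p, ⟨⟨a, a, left_mem_seg _ _⟩, T.smul_mem a p hp⟩, b • p,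
      ⟨⟨b, b, left_mem_seg _ _⟩, T.smul_mem b p hp⟩, hx⟩
  · rintro g x ⟨a, b, hx⟩
    exact ⟨g * a, g * b, by rw [mul_smul, mul_smul, smul_mem_seg_iff]; exact hx⟩

/-- Each side of an edge of a minimal tree contains a point of each orbit of vertices. -/
theorem IsMinimal.exists_mem_side (hT : T.IsMinimal) {u v p : T} (he : IsEdge T.verts u v)
    (hp : p ∈ T.verts) : ∃ g : G, v ∈ seg u (g • p) := by
  obtain ⟨γ, h0, h1, hγ⟩ := T.isRealTree.geodesic u v
  have hpos := dist_pos.2 he.2.2.1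
  have hI : dist u v / 2 ∈ Set.Icc 0 (dist u v) := ⟨by linarith, by linarith⟩
  set m := γ (dist u v / 2) with hm
  have a1 : dist u m = dist u v / 2 := by
    rw [← h0, hm, hγ 0 ⟨le_rfl, hpos.le⟩ _ hI, h0, zero_sub, abs_neg, abs_of_nonneg hI.1]
  have a2 : dist m v = dist u v / 2 := by
    have := hγ _ hI (dist u v) ⟨hpos.le, le_rfl⟩
    rw [h1, abs_sub_comm, abs_of_nonneg (by linarith)] at this
    linarith
  obtain ⟨g, h, hgh⟩ := hT.exists_mem_seg_smul hp m
  -- If the whole orbit lay on the side of `u`, the segment through the midpoint `m` would pass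
  -- through `u` both before and after `m`.
  by_contra! hcon
  have key : ∀ t : G, dist m (t • p) = dist m u + dist u (t • p) := by
    intro t
    rcases T.isTree.mem_seg_or_of_isEdge he (T.smul_mem t p hp) with h | h
    · exact absurd h (hcon t)
    · rw [mem_seg_iff] at h
      have t1 := dist_triangle v m (t • p)
      have t2 := dist_triangle m u (t • p)
      have e1 := dist_comm m u
      have e2 := dist_comm v m
      have e3 := dist_comm v u
      linarith
  rw [mem_seg_iff, dist_comm (g • p) m, key g, key h] at hgh
  have t1 := dist_triangle (g • p) u (h • p)
  have e1 := dist_comm m u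
  have e2 := dist_comm (g • p) u
  linarith

/-- Take `g • u` on the far side of `v`. Then the translated edge lies beyond the edge in one of the
two orientations, the only other configuration being an inversion. -/
theorem IsMinimal.exists_coherent_or (hT : T.IsMinimal) {u v : T} (he : IsEdge T.verts u v) :
    ∃ g : G, Coherent u v (g • u) (g • v) ∨ Coherent u v (g • v) (g • u) := by
  obtain ⟨g, hg⟩ := hT.exists_mem_side he he.1
  refine ⟨g, ?_⟩
  rcases T.isTree.mem_seg_or_of_isEdge he (T.smul_mem g v he.2.1) with h | h
  · rcases T.isTree.mem_seg_or_of_isEdge (T.isEdge_smul g he) he.1 with h' | h'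
    · exact Or.inr (coherent_of_mem_seg h (mem_seg_comm.1 h'))
    · exact Or.inl (coherent_of_mem_seg hg (mem_seg_comm.1 h'))
  · exfalso
    have h1 := T.isRealTree.dist_eq_of_mem_seg (mem_seg_comm.1 hg) h he.2.2.1.symm
    rw [dist_smul, dist_comm v u] at h1
    have n1 : 0 ≤ dist (g • u) v := dist_nonneg
    have n2 : 0 ≤ dist u (g • v) := dist_nonneg
    exact T.no_inversion g u v he ⟨dist_le_zero.1 (by linarith),
      (dist_le_zero.1 (show dist u (g • v) ≤ 0 by linarith)).symm⟩

/-- Every oriented edge of a minimal tree lies on the axis of a hyperbolic element. -/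
theorem IsMinimal.exists_coherent_smul (hT : T.IsMinimal) {u v : T} (he : IsEdge T.verts u v) :
    ∃ k : G, Coherent u v (k • u) (k • v) := by
  obtain ⟨g, hg | hg⟩ := hT.exists_coherent_or he
  · exact ⟨g, hg⟩
  obtain ⟨g', hg' | hg'⟩ := hT.exists_coherent_or he.symm
  · refine ⟨g'⁻¹, (coherent_smul_iff g').1 ?_⟩
    simpa using hg'.symm
  -- Both `g` and `g'` reverse the orientation, so their product preserves it.
  · refine ⟨g * g', hg.trans T.isRealTree (p := (g * g') • u) (q := (g * g') • v) ?_ ?_⟩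
    · rw [mul_smul, mul_smul, coherent_smul_iff]
      exact hg'
    · exact fun h => he.2.2.1 (MulAction.injective g h).symm

/-- The powers of a hyperbolic element translate a point of its axis along a ray. -/
theorem isRay_pow_smul {u v : T} (hne : u ≠ v) {k : G} (hk : Coherent u v (k • u) (k • v)) :
    IsRay (fun n : ℕ => k ^ n • u) (dist u (k • u)) := by
  have h1 : v ∈ seg u (k • u) := hk.left_mem.2
  have h2 : k • v ∈ seg (k • u) (k • k • u) := (smul_mem_seg_iff k).2 h1
  have h3 : k • u ≠ k • v := fun h => hne (MulAction.injective k h)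
  have h4 : k • u ∈ seg u (k • k • u) := by
    have ha := T.isRealTree.mem_seg_trans hk.right_mem.1 h2 h3
    exact (mem_seg_of_mem_left ha hk.right_mem.1).1
  refine ⟨?_, fun n => ?_, fun n => ?_⟩
  · rw [mem_seg_iff] at h1
    have := dist_pos.2 hne
    have h0 : 0 ≤ dist v (k • u) := dist_nonneg
    linarith
  · simp only [pow_succ, mul_smul, dist_smul]
  · simp only [pow_succ, mul_smul, smul_mem_seg_iff]
    exact h4

theorem isRay_inv_pow_smul {u v : T} (hne : u ≠ v) {k : G}
    (hk : Coherent u v (k • u) (k • v)) :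
    IsRay (fun n : ℕ => k⁻¹ ^ n • u) (dist u (k • u)) := by
  have hr := isRay_pow_smul hne hk
  have c1 : ∀ (n : ℕ) (x : T), k⁻¹ ^ n • x = k⁻¹ ^ (n + 1) • k • x := fun n x => by
    rw [pow_succ, mul_smul, inv_smul_smul]
  refine ⟨hr.pos, fun n => ?_, fun n => ?_⟩
  · rw [c1 n, dist_smul, dist_comm]
  · rw [c1 n, c1 (n + 1), c1 (n + 1), smul_mem_seg_iff, mem_seg_comm]
    simpa [pow_succ, mul_smul] using hr.mem_seg 0

/-- If each translate of a ray has the same end as a given ray, the group fixes this end; when the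
stabilizers along the ray are cyclic, it follows that the group is solvable. -/
theorem isSolvable_of_busemann {B : T → ℝ} {a b : ℕ → T} {l l' : ℝ} (hb : IsRay b l')
    (hB : ∀ x, ∀ᶠ n : ℕ in atTop, dist x (a n) = B x + n * l)
    (hBb : ∀ (g : G) m, B (g • b m) = B (g • b (m + 1)) + l')
    (hstab : ∀ m, IsCyclic (MulAction.stabilizer G (b m))) : Group.IsSolvable G := by
  have hX := T.isRealTree
  have hlin : ∀ (g : G) (m : ℕ), B (g • b m) = B (g • b 0) - m * l' := by
    intro g m
    induction m with
    | zero => simp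
    | succ m ih =>
      have := hBb g m
      push_cast
      linarith
  -- Every path from `g • x` to the end of `a` finally follows the ray `g • b`. Hence `B ∘ g` is, up
  -- to a constant, the Busemann function of `b`, and `hadd` makes `B (g • x) - B x` independent of
  -- `x`.
  have key : ∀ (g : G) (x : T), ∀ᶠ m : ℕ in atTop,
      B (g • x) = B (g • b 0) - m * l' + dist x (b m) := by
    intro g x
    filter_upwards [hb.eventually_mem_seg hX x] with m hm
    obtain ⟨n, h1, h2, h3⟩ := ((hB (g • x)).and ((hB (g • b m)).and (hB (g • b (m + 1))))).exists
    have hd : dist (g • b m) (g • b (m + 1)) = l' := by rw [dist_smul, hb.dist_succ]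
    have hs : g • b (m + 1) ∈ seg (g • b m) (a n) := by
      have := hBb g m
      rw [mem_seg_iff]
      linarith
    have hs' : g • b m ∈ seg (g • x) (g • b (m + 1)) := (smul_mem_seg_iff g).2 hm
    have := hX.dist_eq_of_mem_seg hs' hs (fun h => hb.ne m (MulAction.injective g h))
    rw [dist_smul] at this
    have := hlin g m
    have := hBb g m
    linarith
  have hadd : ∀ (g : G) (x : T), B (g • x) = B x + (B (g • b 0) - B (b 0)) := by
    intro g x
    obtain ⟨m, h1, h2⟩ := ((key g x).and (key 1 x)).exists
    simp only [one_smul] at h2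
    linarith
  let β : G →* Multiplicative ℝ :=
    { toFun := fun g => Multiplicative.ofAdd (B (g • b 0) - B (b 0))
      map_one' := by simp
      map_mul' := fun g h => by
        rw [← ofAdd_add, mul_smul, hadd g (h • b 0)]
        congr 1
        ring }
  -- For large `m`, both `g • b m` and `b m` lie on the path from `g • b 0` to the end of `a`, at
  -- the same distance `m * l'`; so they coincide.
  have hfix : ∀ g ∈ β.ker, ∀ᶠ m in atTop, g • b m = b m := by
    intro g hg
    have hg0 : B (g • b 0) = B (b 0) := by
      have : B (g • b 0) - B (b 0) = 0 := hg
      linarith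
    filter_upwards [key 1 (g • b 0)] with m hm
    simp only [one_smul] at hm
    obtain ⟨n, h1, h2, h3⟩ := ((hB (g • b 0)).and ((hB (g • b m)).and (hB (b m)))).exists
    have h4 := hX.fourPoint (g • b m) (b m) (g • b 0) (a n)
    have e1 := hlin g m
    have e2 := hlin 1 m
    simp only [one_smul] at e2
    have e3 : dist (g • b m) (g • b 0) ≤ m * l' := by
      rw [dist_smul, dist_comm]
      exact hb.dist_le m
    have e4 := dist_comm (b m) (g • b 0)
    apply dist_le_zero.1
    rcases le_max_iff.1 h4 with h | h <;> linarith
  have hker : Group.IsSolvable β.ker := by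
    apply Group.isSolvable_of_comm
    rintro ⟨g, hg⟩ ⟨h, hh⟩
    obtain ⟨m, hm1, hm2⟩ := ((hfix g hg).and (hfix h hh)).exists
    have := hstab m
    have hc := (IsCyclic.commGroup (α := MulAction.stabilizer G (b m))).mul_comm ⟨g, hm1⟩ ⟨h, hm2⟩
    exact Subtype.ext (congrArg (fun x : MulAction.stabilizer G (b m) => (x : G)) hc)
  exact Group.isSolvable_of_ker_le_range β.ker.subtype β (by simp)

/-- If `G` is not solvable, any edge can be translated beyond any edge, with a given orientation. -/
theorem InCyclicDeformationSpace.exists_coherent (hT : T.InCyclicDeformationSpace)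
    (hG : ¬ Group.IsSolvable G) {u v w z : T} (he : IsEdge T.verts u v)
    (hf : IsEdge T.verts w z) : ∃ g : G, Coherent u v (g • w) (g • z) := by
  have hX := T.isRealTree
  obtain ⟨k, hk⟩ := hT.minimal.exists_coherent_smul he
  obtain ⟨h, hh⟩ := hT.minimal.exists_coherent_smul hf
  have ha := isRay_pow_smul hf.2.2.1 hh
  have hb := isRay_inv_pow_smul he.2.2.1 hk
  obtain ⟨B, hB⟩ := ha.exists_busemann hX
  by_contra! hcon
  refine hG (isSolvable_of_busemann hb hB (fun g m => ?_)
    (fun m => hT.vertex_stabilizer _ (T.smul_mem _ _ he.1)))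
  obtain ⟨n, h1, h2, h3⟩ := ((hB (g • k⁻¹ ^ m • u)).and ((hB (g • k⁻¹ ^ (m + 1) • u)).and
    (ha.eventually_mem_seg hX (g • k⁻¹ ^ (m + 2) • u)))).exists
  have hs := (hb.smul g).mem_seg m
  have hd1 := (hb.smul g).dist_succ m
  have hd2 := (hb.smul g).dist_succ (m + 1)
  have hdh := ha.dist_succ n
  beta_reduce at hs hd1 hd2 hdh h1 h2 h3
  -- Either the translated ray moves towards the end of `a` at this step, which is the required
  -- decrease of `B`, or it moves away. In the latter case the path from `g • b (m + 2)` to the end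
  -- of `a` crosses a translate of `(u, v)` and then a translate of `(w, z)`, both positively,
  -- against `hcon`.
  rcases hX.mem_seg_or hs (h ^ n • w) with hc | hc
  · rw [mem_seg_iff, dist_comm _ (g • k⁻¹ ^ m • u), dist_comm (h ^ n • w),
      dist_comm (h ^ n • w)] at hc
    linarith
  exfalso
  obtain ⟨r, hr⟩ : ∃ r : G, r = g * k⁻¹ ^ (m + 2) := ⟨_, rfl⟩
  have e1 : g • k⁻¹ ^ (m + 2) • u = r • u := by rw [hr, mul_smul]
  have e2 : g • k⁻¹ ^ (m + 1) • u = r • k • u := by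
    rw [hr, mul_smul, pow_succ _ (m + 1), mul_smul, inv_smul_smul]
  rw [e1] at h3 hc
  rw [e2] at hc
  have c1 : r • v ∈ seg (r • u) (r • k • u) := (smul_mem_seg_iff r).2 hk.left_mem.2
  have c2 : r • v ∈ seg (r • u) (h ^ n • w) :=
    (mem_seg_of_mem_left (mem_seg_comm.1 hc) c1).1
  have c3 : h ^ n • z ∈ seg (h ^ n • w) (h ^ (n + 1) • w) := by
    rw [pow_succ, mul_smul, smul_mem_seg_iff]
    exact hh.left_mem.2
  have c4 := (mem_seg_of_mem_right h3 c3).2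
  refine hcon (r⁻¹ * h ^ n) ((coherent_smul_iff r).1 ?_)
  rw [mul_smul, mul_smul, smul_inv_smul, smul_inv_smul]
  exact coherent_of_mem_seg c2 c4

end GTree

namespace GTree

variable {G : Type*} [Group G] {T : GTree G}

/-! ## Reduced edge paths -/

/-- The path that crosses `e` and then `f` is reduced. -/
def OrientedEdge.Follows (e f : T.OrientedEdge) : Prop :=
  e.tgt = f.src ∧ e.tgt ∈ seg e.src f.tgt

theorem OrientedEdge.Follows.translate {e f : T.OrientedEdge} (h : e.Follows f) (g : G) :
    (e.translate g).Follows (f.translate g) :=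
  ⟨congrArg (g • ·) h.1, (smul_mem_seg_iff g).2 h.2⟩

theorem OrientedEdge.translate_inv_translate (g : G) (e : T.OrientedEdge) :
    (e.translate g).translate g⁻¹ = e := by
  ext <;> simp [OrientedEdge.translate]

theorem OrientedEdge.translate_translate (g h : G) (e : T.OrientedEdge) :
    (e.translate g).translate h = e.translate (h * g) := by
  ext <;> simp [OrientedEdge.translate, mul_smul]

theorem OrientedEdge.length_pos (e : T.OrientedEdge) : 0 < e.length := dist_pos.2 e.isEdge.2.2.1

/-- The edges `E 0, ..., E n` form a reduced path. -/
def IsChain (E : ℕ → T.OrientedEdge) (n : ℕ) : Prop := ∀ i < n, (E i).Follows (E (i + 1))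

namespace IsChain

variable {E : ℕ → T.OrientedEdge} {n : ℕ}

theorem dist_eq_sum (hE : IsChain E n) : (E n).src ∈ seg (E 0).src (E n).tgt ∧
    dist (E 0).src (E n).tgt = ∑ i ∈ Finset.range (n + 1), (E i).length := by
  induction n with
  | zero => simpa [OrientedEdge.length] using left_mem_seg _ _
  | succ n ih =>
    obtain ⟨h1, h2⟩ := ih fun i hi => hE i (by omega)
    obtain ⟨h3, h4⟩ := hE n (by omega)
    have h5 := T.isRealTree.mem_seg_trans h1 h4 (E n).isEdge.2.2.1
    rw [h3] at h5
    refine ⟨h5, ?_⟩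
    rw [Finset.sum_range_succ, ← h2, ← mem_seg_iff.1 h5, h3]
    rfl

theorem coherent (hE : IsChain E n) (hn : 1 ≤ n) :
    Coherent (E 0).src (E 0).tgt (E n).src (E n).tgt ∧
      dist (E 0).tgt (E n).src ≤ ∑ i ∈ Finset.Ico 1 n, (E i).length := by
  have h1 : dist (E 0).tgt (E n).src ≤ ∑ i ∈ Finset.Ico 1 n, (E i).length := by
    rw [(hE 0 (by omega)).1]
    refine (dist_le_Ico_sum_dist (fun i => (E i).src) hn).trans_eq
      (Finset.sum_congr rfl fun i hi => ?_)
    rw [← (hE i (Finset.mem_Ico.1 hi).2).1]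
    rfl
  refine ⟨?_, h1⟩
  have h2 := hE.dist_eq_sum.2
  rw [Finset.sum_range_succ, Finset.range_eq_Ico,
    Finset.sum_eq_sum_Ico_succ_bot (by omega : 0 < n)] at h2
  have t1 := dist_triangle (E 0).src (E 0).tgt (E n).tgt
  have t2 := dist_triangle (E 0).tgt (E n).src (E n).tgt
  unfold Coherent
  simp only [OrientedEdge.length, zero_add] at *
  linarith

/-- When an oriented edge is repeated up to translation, a reduced path can be shortened. -/
theorem splice (hE : IsChain E n) {i j : ℕ} (hij : i < j) (hj : j < n) {k : G}
    (hk : E j = (E i).translate k) :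
    -- The edges `i + 1, ..., j` are cut out, and the rest is moved back by `k⁻¹` so that it
    -- continues `E i`.
    IsChain (fun m => if m ≤ i then E m else (E (m + (j - i))).translate k⁻¹) (n - (j - i)) := by
  intro m hm
  rcases lt_trichotomy m i with h | rfl | h
  · simp only [if_pos h.le, if_pos (show m + 1 ≤ i by omega)]
    exact hE m (by omega)
  · have h1 := (hE j hj).translate k⁻¹
    rw [hk, OrientedEdge.translate_inv_translate] at h1
    simp only [le_refl, if_true, if_neg (show ¬ m + 1 ≤ m by omega)]
    rwa [show m + 1 + (j - m) = j + 1 by omega]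
  · simp only [if_neg (show ¬ m ≤ i by omega), if_neg (show ¬ m + 1 ≤ i by omega)]
    rw [show m + 1 + (j - i) = m + (j - i) + 1 by omega]
    exact (hE _ (by omega)).translate k⁻¹

end IsChain

/-- Induction on the number of vertices between the two edges, splitting off the first edge of the
gap. -/
theorem exists_isChain {e f : T.OrientedEdge} (h : Coherent e.src e.tgt f.src f.tgt) :
    ∃ n, 1 ≤ n ∧ ∃ E : ℕ → T.OrientedEdge, E 0 = e ∧ E n = f ∧ IsChain E n := by
  induction hN : (seg e.tgt f.src ∩ T.verts).ncard using Nat.strong_induction_on generalizing e with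
  | _ N ih =>
    by_cases hne : e.tgt = f.src
    · refine ⟨1, le_rfl, fun i => if i = 0 then e else f, by simp, by simp, ?_⟩
      intro i hi
      obtain rfl : i = 0 := by omega
      simpa using ⟨hne, h.left_mem.1⟩
    obtain ⟨c, hc, hec⟩ := T.isTree.exists_isEdge_left e.isEdge.2.1 f.isEdge.1 hne
    have h1 : e.tgt ∈ seg e.src c := (mem_seg_of_mem_right h.left_mem.2 hc).2
    have h2 : Coherent e.tgt c f.src f.tgt := coherent_of_mem_seg hc h.right_mem.2
    have hlt : (seg c f.src ∩ T.verts).ncard < (seg e.tgt f.src ∩ T.verts).ncard := by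
      refine Set.ncard_lt_ncard ?_ (T.isTree.finite_inter _ _)
      rw [Set.ssubset_iff_of_subset
        (Set.inter_subset_inter_left _ fun z hz => (mem_seg_of_mem_right hc hz).1)]
      refine ⟨e.tgt, ⟨left_mem_seg _ _, e.isEdge.2.1⟩, fun hcon => hec.2.2.1 ?_⟩
      have h3 := hcon.1
      rw [mem_seg_iff] at h3 hc
      have h4 := dist_comm e.tgt c
      have h5 : 0 ≤ dist e.tgt c := dist_nonneg
      exact dist_le_zero.1 (by linarith)
    obtain ⟨n, hn, E, hE0, hEn, hE⟩ := ih _ (hN ▸ hlt) (e := ⟨e.tgt, c, hec⟩) h2 rfl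
    refine ⟨n + 1, by omega, fun i => if i = 0 then e else E (i - 1), by simp, by simpa, ?_⟩
    intro i hi
    rcases Nat.eq_zero_or_pos i with rfl | hi0
    · simp only [if_true, zero_add, one_ne_zero, if_false, Nat.sub_self, hE0]
      exact ⟨rfl, h1⟩
    · simp only [if_neg hi0.ne', if_neg (Nat.succ_ne_zero i)]
      have := hE (i - 1) (by omega)
      rwa [show i - 1 + 1 = i + 1 - 1 by omega] at this

/-! ### Edge lengths and volume -/

theorem ofReal_length_eq (e : T.OrientedEdge) :
    ENNReal.ofReal e.length = T.quotientLength (Quotient.mk T.edgeOrbit e) := rfl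

theorem OrientedEdge.length_le_of_vol (hvol : T.vol = 1) (e : T.OrientedEdge) :
    e.length ≤ 1 := by
  rw [← ENNReal.ofReal_le_one, ← hvol, ofReal_length_eq]
  exact ENNReal.le_tsum _

/-- The total length of edges in pairwise distinct oriented orbits is at most twice the volume. -/
theorem sum_length_le_of_vol (hvol : T.vol = 1) (s : Finset ℕ) (E : ℕ → T.OrientedEdge)
    (hE : ∀ i ∈ s, ∀ j ∈ s, i < j → ∀ k : G, E j ≠ (E i).translate k) :
    ∑ i ∈ s, (E i).length ≤ 2 := by
  classical
  have hE' : ∀ i ∈ s, ∀ j ∈ s, i ≠ j → ∀ k : G, E j ≠ (E i).translate k := by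
    intro i hi j hj hne k hk
    rcases lt_or_gt_of_ne hne with h | h
    · exact hE i hi j hj h k hk
    · refine hE j hj i hi h k⁻¹ ?_
      rw [hk, OrientedEdge.translate_inv_translate]
  -- An unoriented orbit consists of at most two oriented ones; this is the factor `2`.
  have hcard : ∀ q : Quotient T.edgeOrbit,
      (s.filter fun i => Quotient.mk T.edgeOrbit (E i) = q).card ≤ 2 := by
    intro q
    by_contra! hcon
    obtain ⟨a, ha, b, hb, c, hc, hab, hac, hbc⟩ := Finset.two_lt_card.1 hcon
    rw [Finset.mem_filter] at ha hb hc
    obtain ⟨g, h1 | h1⟩ := Quotient.exact (ha.2.trans hb.2.symm)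
    · exact hE' a ha.1 b hb.1 hab g (OrientedEdge.ext h1.1.symm h1.2.symm)
    obtain ⟨h, h2 | h2⟩ := Quotient.exact (ha.2.trans hc.2.symm)
    · exact hE' a ha.1 c hc.1 hac h (OrientedEdge.ext h2.1.symm h2.2.symm)
    refine hE' b hb.1 c hc.1 hbc (h * g⁻¹) (OrientedEdge.ext ?_ ?_)
    · simp [OrientedEdge.translate, mul_smul, ← h1.2, ← h2.2]
    · simp [OrientedEdge.translate, mul_smul, ← h1.1, ← h2.1]
  have hle : ENNReal.ofReal (∑ i ∈ s, (E i).length) ≤ 2 := by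
    rw [ENNReal.ofReal_sum_of_nonneg fun i _ => (E i).length_pos.le]
    simp only [ofReal_length_eq]
    rw [Finset.sum_comp T.quotientLength fun i => Quotient.mk T.edgeOrbit (E i)]
    calc _ ≤ ∑ q ∈ s.image fun i => Quotient.mk T.edgeOrbit (E i), 2 * T.quotientLength q := by
          refine Finset.sum_le_sum fun q _ => ?_
          rw [nsmul_eq_mul]
          gcongr
          exact_mod_cast hcard q
      _ ≤ 2 * T.vol := by
          rw [← Finset.mul_sum]
          gcongr
          exact ENNReal.sum_le_tsum _
      _ = 2 := by rw [hvol, mul_one]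
  rw [← ENNReal.ofReal_ofNat 2] at hle
  exact (ENNReal.ofReal_le_ofReal_iff (by norm_num)).1 hle

theorem exists_coherent_dist_le (hvol : T.vol = 1) {e f : T.OrientedEdge}
    (h : ∃ g : G, Coherent e.src e.tgt (g • f.src) (g • f.tgt)) :
    ∃ g : G, Coherent e.src e.tgt (g • f.src) (g • f.tgt) ∧ dist e.tgt (g • f.src) ≤ 2 := by
  classical
  have hex : ∃ n, 1 ≤ n ∧ ∃ (g : G) (E : ℕ → T.OrientedEdge),
      E 0 = e ∧ E n = f.translate g ∧ IsChain E n := by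
    obtain ⟨g, hg⟩ := h
    obtain ⟨n, hn, E, h⟩ := exists_isChain (e := e) (f := f.translate g) hg
    exact ⟨n, hn, g, E, h⟩
  obtain ⟨hn, g, E, h0, hEn, hE⟩ := Nat.find_spec hex
  set n := Nat.find hex with hndef
  -- A repetition would let `splice` shorten a path of minimal length. Only interior edges matter:
  -- the path keeps its first edge `e`, and its last edge stays a translate of `f`.
  have hrep : ∀ i ∈ Finset.Ico 1 n, ∀ j ∈ Finset.Ico 1 n, i < j →
      ∀ k : G, E j ≠ (E i).translate k := by
    intro i hi j hj hij k hk
    rw [Finset.mem_Ico] at hi hj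
    refine Nat.find_min hex (m := n - (j - i)) (by omega) ⟨by omega, k⁻¹ * g, _, ?_, ?_,
      hE.splice hij hj.2 hk⟩
    · simpa using h0
    · simp only [if_neg (show ¬ n - (j - i) ≤ i by omega)]
      rw [show n - (j - i) + (j - i) = n by omega, hEn, OrientedEdge.translate_translate]
  obtain ⟨h1, h2⟩ := hE.coherent hn
  rw [h0, hEn] at h1 h2
  exact ⟨g, h1, h2.trans (sum_length_le_of_vol hvol _ E hrep)⟩

/-! ## Hyperbolic elements with a prescribed long segment in the axis -/

/-- Place `g • [x, z]`, the translate of the first edge of `[x, y]`, beyond the last edge `[u, y]`.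
Then `x`, `y`, `g • x`, `g • g • x` are aligned in this order, so `dist x (g • g • x) = 2 * dist x
(g • x)` and `dist_sub_le_dist_smul` bounds all displacements from below. -/
theorem InCyclicDeformationSpace.exists_displacement (hT : T.InCyclicDeformationSpace)
    (hG : ¬ Group.IsSolvable G) (hvol : T.vol = 1) {x y : T} (hx : x ∈ T.verts)
    (hy : y ∈ T.verts) (hne : x ≠ y) :
    ∃ g : G, dist y (g • x) ≤ 2 ∧ ∀ z : T, dist x y ≤ dist z (g • z) := by
  have hX := T.isRealTree
  obtain ⟨z, hz, hxz⟩ := T.isTree.exists_isEdge_left hx hy hne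
  obtain ⟨u, hu, hyu⟩ := T.isTree.exists_isEdge_left hy hx hne.symm
  obtain ⟨g, hg, hd⟩ := exists_coherent_dist_le hvol (e := ⟨u, y, hyu.symm⟩) (f := ⟨x, z, hxz⟩)
    (hT.exists_coherent hG hyu.symm hxz)
  simp only at hg hd
  refine ⟨g, hd, fun p => le_trans ?_ (hX.dist_sub_le_dist_smul g x p)⟩
  rw [mem_seg_comm] at hu
  have h1 : y ∈ seg x (g • x) := hX.mem_seg_trans hu hg.left_mem.2 hyu.2.2.1.symm
  have h2 : u ∈ seg x (g • x) := (mem_seg_of_mem_left h1 hu).1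
  have h3 : z ∈ seg x (g • x) := (mem_seg_of_mem_left h1 hz).1
  have hne' : u ≠ g • x := by
    rintro rfl
    have := hg.left_mem.2
    rw [mem_seg_iff, dist_self] at this
    have h0 : 0 ≤ dist y (g • x) := dist_nonneg
    have h0' : 0 < dist (g • x) y := dist_pos.2 hyu.2.2.1.symm
    linarith
  have h4 : g • x ∈ seg x (g • z) := hX.mem_seg_trans h2 hg.right_mem.1 hne'
  have h5 : g • z ∈ seg (g • x) (g • g • x) := (smul_mem_seg_iff g).2 h3
  have h6 := hX.dist_eq_of_mem_seg h4 h5 fun h => hxz.2.2.1 (MulAction.injective g h)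
  rw [mem_seg_iff] at h1 h5
  rw [dist_smul g x (g • x)] at h5
  have h0 : 0 ≤ dist y (g • x) := dist_nonneg
  linarith

theorem exists_vert_dist_le (hvol : T.vol = 1) (x : T) : ∃ v ∈ T.verts, dist x v ≤ 1 / 2 := by
  by_cases hx : x ∈ T.verts
  · exact ⟨x, hx, by simp⟩
  obtain ⟨c, d, hcd, hxs⟩ := T.isTree.exists_isEdge_mem_seg hx
  have h1 : dist c d ≤ 1 := OrientedEdge.length_le_of_vol hvol ⟨c, d, hcd⟩
  rw [mem_seg_iff, dist_comm c x] at hxs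
  by_cases h : dist x c ≤ 1 / 2
  · exact ⟨c, hcd.1, h⟩
  · exact ⟨d, hcd.2.1, by linarith⟩

end GTree

/-! ## Quasi-isometries -/

theorem dist_le_of_lipConst_le {X Y : Type*} [MetricSpace X] [MetricSpace Y] {f : X → Y} {D : ℝ}
    (h : lipConst f ≤ ENNReal.ofReal D) (hD : 0 ≤ D) (x y : X) :
    dist (f x) (f y) ≤ D * dist x y := by
  have key : ∀ ε > 0, dist (f x) (f y) ≤ (D + ε) * dist x y := by
    intro ε hε
    have hlt : lipConst f < ENNReal.ofReal (D + ε) :=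
      h.trans_lt ((ENNReal.ofReal_lt_ofReal_iff (by linarith)).2 (by linarith))
    simp only [lipConst, iInf_lt_iff] at hlt
    obtain ⟨K, hK, hKlt⟩ := hlt
    have hKD : (K : ℝ) ≤ D + ε := by
      have := ENNReal.toReal_mono ENNReal.ofReal_ne_top hKlt.le
      rwa [ENNReal.coe_toReal, ENNReal.toReal_ofReal (by linarith)] at this
    exact (hK.dist_le_mul x y).trans (by gcongr)
  have hlim : Tendsto (fun ε : ℝ => (D + ε) * dist x y) (nhdsWithin 0 (Set.Ioi 0))
      (nhds ((D + 0) * dist x y)) :=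
    (Continuous.tendsto (by fun_prop) 0).mono_left nhdsWithin_le_nhds
  rw [add_zero] at hlim
  exact ge_of_tendsto hlim (by filter_upwards [self_mem_nhdsWithin] with ε hε using key ε hε)

variable {G : Type*} [Group G] {T S : GTree G}

/-- A comparison of displacements in two trees. -/
theorem le_mul_dist_smul_of_Lip_le {D : ℝ} (hD : 0 ≤ D) (h : Lip S T ≤ ENNReal.ofReal D) {g : G}
    {c : ℝ} (hc : ∀ z : T, c ≤ dist z (g • z)) (y : S) : c ≤ D * dist y (g • y) := by
  -- The infimum `Lip S T` need not be attained, hence the `ε`.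
  have key : ∀ ε > 0, c ≤ (D + ε) * dist y (g • y) := by
    intro ε hε
    have hlt : Lip S T < ENNReal.ofReal (D + ε) :=
      h.trans_lt ((ENNReal.ofReal_lt_ofReal_iff (by linarith)).2 (by linarith))
    simp only [Lip, iInf_lt_iff] at hlt
    obtain ⟨f, hf, hflt⟩ := hlt
    refine (hc (f y)).trans ?_
    rw [← hf g y]
    exact dist_le_of_lipConst_le hflt.le (by linarith) _ _
  have hlim : Tendsto (fun ε : ℝ => (D + ε) * dist y (g • y)) (nhdsWithin 0 (Set.Ioi 0))
      (nhds ((D + 0) * dist y (g • y))) :=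
    (Continuous.tendsto (by fun_prop) 0).mono_left nhdsWithin_le_nhds
  rw [add_zero] at hlim
  exact ge_of_tendsto hlim (by filter_upwards [self_mem_nhdsWithin] with ε hε using key ε hε)

/-- Between vertices the error is `2 * D`. Moving `x` and `y` to vertices within `1 / 2` costs `D /
2` each in `S`, and `D⁻¹ * 1 ≤ D` for the change of `dist x y`; the total is `4 * D`. -/
theorem dist_lower_bound (hG : ¬ Group.IsSolvable G) (hT : T.InCyclicDeformationSpace)
    (hTvol : T.vol = 1) {D : ℝ} (hD : 1 ≤ D) (hLip : Lip S T ≤ ENNReal.ofReal D) {τ : T → S}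
    (hτ : Equivariant T S τ) (hτD : ∀ x y, dist (τ x) (τ y) ≤ D * dist x y) (x y : T) :
    D⁻¹ * dist x y - 4 * D ≤ dist (τ x) (τ y) := by
  have hD0 : 0 < D := by linarith
  have hDinv : D⁻¹ ≤ D := (inv_le_one_of_one_le₀ hD).trans hD
  have hDpos : 0 < D⁻¹ := inv_pos.2 hD0
  obtain ⟨v, hv, hxv⟩ := T.exists_vert_dist_le hTvol x
  obtain ⟨w, hw, hyw⟩ := T.exists_vert_dist_le hTvol y
  have hvert : D⁻¹ * dist v w - 2 * D ≤ dist (τ v) (τ w) := by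
    by_cases hne : v = w
    · subst hne
      simp only [dist_self, mul_zero]
      linarith
    obtain ⟨g, hg1, hg2⟩ := hT.exists_displacement hG hTvol hv hw hne
    have h1 := le_mul_dist_smul_of_Lip_le hD0.le hLip hg2 (τ v)
    have h2 : D⁻¹ * dist v w ≤ dist (τ v) (g • τ v) := by
      rw [inv_mul_le_iff₀ hD0]
      exact h1
    have h3 : dist (τ w) (g • τ v) ≤ D * 2 := by
      rw [← hτ g v]
      exact (hτD _ _).trans (by gcongr)
    have h4 := dist_triangle (τ v) (τ w) (g • τ v)
    linarith
  have h1 : dist (τ x) (τ v) ≤ D * (1 / 2) := (hτD _ _).trans (by gcongr)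
  have h2 : dist (τ y) (τ w) ≤ D * (1 / 2) := (hτD _ _).trans (by gcongr)
  have h3 : dist (τ v) (τ w) ≤ dist (τ x) (τ v) + dist (τ x) (τ y) + dist (τ y) (τ w) := by
    rw [dist_comm (τ x) (τ v)]
    exact dist_triangle4 _ _ _ _
  have h4 : dist x y ≤ dist v w + 1 := by
    have := dist_triangle4 x v w y
    rw [dist_comm w y] at this
    linarith
  have h5 : D⁻¹ * dist x y ≤ D⁻¹ * (dist v w + 1) := by gcongr
  linarith

/-- The image of a segment under a Lipschitz map between trees is close to the segment between the
images of its ends. -/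
theorem exists_dist_le_of_mem_seg {X Y : Type*} [MetricSpace X] [MetricSpace Y]
    (hX : IsRealTree X) (hY : IsRealTree Y) {D : ℝ} (hD : 0 ≤ D) {f : X → Y}
    (hf : ∀ x y, dist (f x) (f y) ≤ D * dist x y) {a b : X} {z : Y}
    (hz : z ∈ seg (f a) (f b)) : ∃ x, dist z (f x) ≤ D := by
  classical
  obtain ⟨γ, h0, h1, hγ⟩ := hX.geodesic a b
  have hL : 0 ≤ dist a b := dist_nonneg
  let p : ℕ → X := fun i => γ (min (i : ℝ) (dist a b))
  have hp0 : p 0 = a := by simp [p, hL, h0]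
  have hstep : ∀ i, dist (p i) (p (i + 1)) ≤ 1 := by
    intro i
    have hi : (0 : ℝ) ≤ i := Nat.cast_nonneg i
    simp only [p]
    rw [hγ _ ⟨le_min hi hL, min_le_right _ _⟩ _
      ⟨le_min (by positivity) hL, min_le_right _ _⟩]
    refine (abs_min_sub_min_le_max _ _ _ _).trans ?_
    simp
  -- Walk along `[a, b]` in steps of length at most `1`. At the first `i` with `z` on `[f a, f (p
  -- i)]`, the last step has jumped over `z`, and its image has length at most `D`.
  have hex : ∃ i, z ∈ seg (f a) (f (p i)) := by
    obtain ⟨n, hn⟩ := exists_nat_ge (dist a b)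
    exact ⟨n, by simpa only [p, min_eq_right hn, h1] using hz⟩
  have hspec := Nat.find_spec hex
  rcases Nat.eq_zero_or_pos (Nat.find hex) with hi | hi
  · rw [hi, hp0, mem_seg_iff, dist_self] at hspec
    refine ⟨a, ?_⟩
    have h2 : 0 ≤ dist (f a) z := dist_nonneg
    linarith
  · have hmin := Nat.find_min hex (Nat.sub_lt hi one_pos)
    refine ⟨p (Nat.find hex), ?_⟩
    rcases hY.mem_seg_or hspec (f (p (Nat.find hex - 1))) with h | h
    · exact absurd (mem_seg_comm.1 h) hmin
    · have h2 := hstep (Nat.find hex - 1)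
      rw [Nat.sub_add_cancel hi] at h2
      have h3 : dist (f (p (Nat.find hex - 1))) (f (p (Nat.find hex))) ≤ D * 1 :=
        (hf _ _).trans (by gcongr)
      have h4 : 0 ≤ dist (f (p (Nat.find hex - 1))) z := dist_nonneg
      rw [mem_seg_iff] at h
      linarith

/-- For a vertex `p` within `1 / 2` of `τ x`, the point `z` lies on some `[g • p, h • p]`. It is
then either on one of the short segments joining these ends to `g • τ x` and `h • τ x`, or on `[τ (g
• x), τ (h • x)]`. -/
theorem exists_dist_map_le (hS : S.InCyclicDeformationSpace)
    (hSvol : S.vol = 1) {D : ℝ} (hD : 1 ≤ D) {τ : T → S}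
    (hτ : Equivariant T S τ) (hτD : ∀ x y, dist (τ x) (τ y) ≤ D * dist x y) (z : S) :
    ∃ x, dist z (τ x) ≤ D := by
  obtain ⟨x, -⟩ := T.isTree.nonempty
  obtain ⟨p, hp, hxp⟩ := S.exists_vert_dist_le hSvol (τ x)
  have hnear : ∀ t : G, z ∈ seg (t • p) (t • τ x) → ∃ x, dist z (τ x) ≤ D := by
    intro t ht
    refine ⟨t • x, ?_⟩
    rw [hτ]
    have h1 : dist (t • p) (t • τ x) ≤ 1 / 2 := by rwa [dist_smul, dist_comm]
    have h2 : 0 ≤ dist (t • p) z := dist_nonneg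
    rw [mem_seg_iff] at ht
    linarith
  obtain ⟨g, h, hz⟩ := hS.minimal.exists_mem_seg_smul hp z
  rcases S.isRealTree.mem_seg_or hz (g • τ x) with h1 | h1
  · exact hnear g (mem_seg_comm.1 h1)
  rcases S.isRealTree.mem_seg_or h1 (h • τ x) with h2 | h2
  · rw [← hτ, ← hτ] at h2
    exact exists_dist_le_of_mem_seg T.isRealTree S.isRealTree (by linarith) hτD h2
  · exact hnear h (mem_seg_comm.1 h2)

end GBS

theorem mainTheorem5 {G : Type*} [Group G] (hGBS : GBS.IsGBS G) (hG : ¬ Group.IsSolvable G)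
    (T S : GBS.GTree G)
    (hT : T.InCyclicDeformationSpace) (hS : S.InCyclicDeformationSpace)
    (hTvol : T.vol = 1) (hSvol : S.vol = 1)
    (D : ℝ) (hD : 1 ≤ D)
    (hLip : max (GBS.Lip T S) (GBS.Lip S T) ≤ ENNReal.ofReal D)
    (τ : T → S) (hτ : GBS.IsOptimal T S τ) :
    GBS.Equivariant T S τ ∧ GBS.IsQuasiIsometry D (4 * D) τ := by
  obtain ⟨hTS, hST⟩ := max_le_iff.1 hLip
  have hD0 : 0 ≤ D := by linarith
  have hτD := GBS.dist_le_of_lipConst_le (hτ.lip_eq.trans_le hTS) hD0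
  refine ⟨hτ.equivariant, GBS.dist_lower_bound hG hT hTvol hD hST hτ.equivariant hτD,
    fun x y => ?_, fun z => ?_⟩
  · linarith [hτD x y]
  · obtain ⟨x, hx⟩ := GBS.exists_dist_map_le hS hSvol hD hτ.equivariant hτD z
    exact ⟨x, by linarith⟩
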